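/- Let $\Omega\subset\mathbb R^3$ be open, let $k=k(x,z,\epsilon):\Omega\to\mathbb R$ be $C^\infty$, and let $[x_1,x_2]$ ($x_1\le x_2$) be a compact interval with $[x_1,x_2]\times\{(0,0)\}\subset\Omega$. Consider the system $$\dot x=k(x,z,zE)\,E,\qquad \dot z=-z,\qquad \dot E=E, \qquad(1)$$ and write $\epsilon=zE$ (which is constant on solutions). A function $h(u,z,w)$ on an open set $U\subset\mathbb R^3$ is called flat in $z$ if for every $(u,0,w)\in U$ and every integer $M\ge0$ one has $h(u,z,w)=\mathcal O(z^M)$ as $z\to0$; it has property $\mathcal F$ in $z$ if $h(u,z,w)-h(u,0,w)$ is flat in $z$. Then there is an $r>0$ such that $(x,z,zE)\in\Omega$ for all $(x,z,E)$ in the box $$B=\{(x,z,E): x_1-r<x<x_2+r,\ |z|<r,\ |E|<r\},$$ and such that for every integer $N\ge1$ there are a $\delta>0$ and a $C^\infty$ coordinate change $(x,z,E)\mapsto(\bar x,z,E)$, $\bar x=\eta_N(x,z,E)$, i.e. a $C^\infty$ diffeomorphism of $W=\{(x,z,E)\in B: |zE|<\delta\}$ onto an open set $V\subset\mathbb R^3$,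 which transforms (1) on $W$ into $$\dot{\bar x}=\epsilon\,a(\bar x,\epsilon)+\epsilon^N b(\bar x,z,E),\qquad \dot z=-z,\qquad \dot E=E,\qquad \epsilon=zE,$$ on $V$, where $b$ is $C^\infty$ on $V$ and $a$ is $C^\infty$ on $\{(\bar x,zE):(\bar x,z,E)\in V\}$. If moreover $k$ has property $\mathcal F$ in $z$ on $\Omega$, then $\eta_N$, $a$ and $b$ can be chosen so that $a=0$ and $b$ is flat in $z$ on $V$. -/

import Mathlib

open Set Filter Topology
open scoped ContDiff

namespace EntryExit

/-- `h (u, z, w)` is flat in `z` on `U`: at every point `(u, 0, w)` of `U`,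
`h (u, z, w) = O(z ^ M)` as `z → 0`, for all `M`. -/
def FlatInZ (h : ℝ × ℝ × ℝ → ℝ) (U : Set (ℝ × ℝ × ℝ)) : Prop :=
  ∀ u w : ℝ, (u, (0 : ℝ), w) ∈ U → ∀ M : ℕ,
    (fun z : ℝ => h (u, z, w)) =O[𝓝 0] (fun z : ℝ => z ^ M)

/-- Property `F` in `z` on `U`: the difference `h (u, z, w) - h (u, 0, w)` is flat in `z`. -/
def PropertyF (h : ℝ × ℝ × ℝ → ℝ) (U : Set (ℝ × ℝ × ℝ)) : Prop :=
  FlatInZ (fun p => h p - h (p.1, 0, p.2.2)) U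

/-- The vector field of the system `x' = k(x, z, zE) E`, `z' = -z`, `E' = E`,
at the point `p = (x, z, E)`. -/
def saddleField (k : ℝ × ℝ × ℝ → ℝ) (p : ℝ × ℝ × ℝ) : ℝ × ℝ × ℝ :=
  (k (p.1, p.2.1, p.2.1 * p.2.2) * p.2.2, -p.2.1, p.2.2)

/-- The vector field of the system `x' = ε a(x, ε) + ε ^ N b(x, z, E)`, `z' = -z`, `E' = E`,
with `ε = zE`, at the point `p = (x, z, E)`. -/
def normalFormField (N : ℕ) (a : ℝ × ℝ → ℝ) (b : ℝ × ℝ × ℝ → ℝ) (p : ℝ × ℝ × ℝ) :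
    ℝ × ℝ × ℝ :=
  ((p.2.1 * p.2.2) * a (p.1, p.2.1 * p.2.2) + (p.2.1 * p.2.2) ^ N * b p, -p.2.1, p.2.2)

/-- The box `x₁ - r < x < x₂ + r`, `|z| < r`, `|E| < r` around the segment
`[x₁, x₂] × {(0, 0)}` of the line of equilibria. -/
def box (x₁ x₂ r : ℝ) : Set (ℝ × ℝ × ℝ) :=
  {p | x₁ - r < p.1 ∧ p.1 < x₂ + r ∧ |p.2.1| < r ∧ |p.2.2| < r}

/-- `Φ` is a smooth coordinate change `(x, z, E) ↦ (η(x, z, E), z, E)`: a diffeomorphism of class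
`C^∞` from its open source onto its open target that leaves `z` and `E` unchanged. -/
structure IsSmoothCoordinateChange
    (Φ : OpenPartialHomeomorph (ℝ × ℝ × ℝ) (ℝ × ℝ × ℝ)) : Prop where
  contDiffOn : ContDiffOn ℝ ∞ Φ Φ.source
  contDiffOn_symm : ContDiffOn ℝ ∞ Φ.symm Φ.target
  snd_eq : ∀ p ∈ Φ.source, (Φ p).2 = p.2

/-- `Φ` transforms the vector field `X` on its source into the vector field `Y` on its target. -/
def Transforms (Φ : OpenPartialHomeomorph (ℝ × ℝ × ℝ) (ℝ × ℝ × ℝ))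
    (X Y : ℝ × ℝ × ℝ → ℝ × ℝ × ℝ) : Prop :=
  ∀ p ∈ Φ.source, fderiv ℝ Φ p (X p) = Y (Φ p)

end EntryExit

/-!
The function `k` is first multiplied by a cutoff that is `1` near the segment, so that it becomes
smooth with compact support on the whole space and every later construction is global; only the
last step returns to the box (`exists_cutoff`).

*Straightening.* Let `φ` be the flow of the scalar equation `u' = k(u, 0, ε)`, with `ε` as a
parameter (`exists_smooth_flow`). Along solutions `ε = zE` is constant, and `y = φ(-E, x, ε)`
satisfies `y' = E ∂ₓφ (k(x, z, ε) - k(x, 0, ε))`, which is `zE g(y, z, E)` by Hadamard's lemma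
(`exists_straightening`). If `k` has property `F`, then `g` is flat in `z`. Smoothness of the flow
is obtained by bootstrapping: the difference of two solutions solves a scalar linear equation,
and its solution formula expresses the derivative of `φ` by exponentials and integrals
of smooth functions of `φ`.

*Normal form.* The remainder at order `ε ^ n` splits as `b(y, 0, 0) + z p(y, z) + E q(y, E) + zE r`.
The first term goes into `a`. The next two lie in the image of the derivation `-z ∂_z + E ∂_E` and
are removed by adding `ε ^ n (P(y, z) - Q(y, E))` to the new coordinate, where `∂_z P = p` and
`∂_E Q = q`, and the last term is of the next order (`exists_normal_form`). The result is
`S = y + ε R(y, z, E)`; no intermediate coordinate change has to be inverted, since all remainders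
remain expressed in `y`. If `g` is flat then all terms put into `a` vanish and all remainders are
flat.

*Flatness.* For smooth functions on the whole space, pointwise flatness is the same as smooth
divisibility by every power of `z` (`FlatInZ.infDivisible`), a form that passes through products,
compositions and difference quotients.

*Inversion.* Since `∂S/∂y = 1 + ε ∂R/∂y`, the coordinate `S` is increasing in `x` on the box as soon
as `|ε| < δ`, where `δ` depends on a bound for `∂R/∂y` on a compact set. The coordinate change is
then injective with invertible derivative (`exists_coordinateChange`). In particular the box
is the same for all orders `N`; only `δ` depends on `N`.
-/

namespace EntryExit

/-! ### Integrals depending on a parameter -/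

theorem hasFDerivAt_integral_of_contDiff {E F : Type} [NormedAddCommGroup E] [NormedSpace ℝ E]
    [ProperSpace E] [NormedAddCommGroup F] [NormedSpace ℝ F] {g : E × ℝ → F}
    (hg : ContDiff ℝ 1 g) (x₀ : E) :
    HasFDerivAt (fun x => ∫ s in (0 : ℝ)..1, g (x, s))
      (∫ s in (0 : ℝ)..1, (fderiv ℝ g (x₀, s)).comp (ContinuousLinearMap.inl ℝ E ℝ)) x₀ := by
  have hg' : Continuous fun q : E × ℝ =>
      (fderiv ℝ g q).comp (ContinuousLinearMap.inl ℝ E ℝ) :=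
    (hg.continuous_fderiv one_ne_zero).clm_comp continuous_const
  have hK : IsCompact (Metric.closedBall x₀ 1 ×ˢ Icc (0 : ℝ) 1) :=
    (isCompact_closedBall x₀ 1).prod isCompact_Icc
  obtain ⟨C, hC⟩ := hK.exists_bound_of_continuousOn hg'.continuousOn
  have hslice (x : E) : Continuous fun s : ℝ => g (x, s) :=
    hg.continuous.comp (by fun_prop)
  refine intervalIntegral.hasFDerivAt_integral_of_dominated_of_fderiv_le
    (F := fun x s => g (x, s))
    (F' := fun x s => (fderiv ℝ g (x, s)).comp (ContinuousLinearMap.inl ℝ E ℝ))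
    (bound := fun _ => C)
    (Metric.closedBall_mem_nhds x₀ one_pos) ?_ ?_ ?_ ?_ ?_ ?_
  · exact .of_forall fun x => (hslice x).aestronglyMeasurable
  · exact (hslice x₀).intervalIntegrable 0 1
  · exact (hg'.comp (by fun_prop : Continuous fun s : ℝ => (x₀, s))).aestronglyMeasurable
  · refine .of_forall fun s hs x hx => hC (x, s) ⟨hx, ?_⟩
    rw [uIoc_of_le zero_le_one] at hs
    exact ⟨hs.1.le, hs.2⟩
  · exact intervalIntegrable_const
  · refine .of_forall fun s _ x _ => ?_
    have h1 : HasFDerivAt (fun x : E => (x, s)) (ContinuousLinearMap.inl ℝ E ℝ) x :=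
      hasFDerivAt_prodMk_left x s
    exact ((hg.differentiable one_ne_zero).differentiableAt.hasFDerivAt (x := (x, s))).comp x h1

theorem contDiff_integral_nat {E : Type} [NormedAddCommGroup E] [NormedSpace ℝ E]
    [ProperSpace E] (n : ℕ) : ∀ {F : Type} [NormedAddCommGroup F] [NormedSpace ℝ F]
    {g : E × ℝ → F}, ContDiff ℝ n g → ContDiff ℝ n fun x => ∫ s in (0 : ℝ)..1, g (x, s) := by
  induction n with
  | zero =>
    intro F _ _ g hg
    simp only [Nat.cast_zero, contDiff_zero] at hg ⊢
    exact intervalIntegral.continuous_parametric_intervalIntegral_of_continuous'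
      (f := fun x s => g (x, s)) hg 0 1
  | succ n ih =>
    intro F _ _ g hg
    push_cast at hg ⊢
    refine contDiff_succ_iff_hasFDerivAt.2
      ⟨_, ?_, hasFDerivAt_integral_of_contDiff (hg.of_le (by simp))⟩
    exact ih (g := fun q => (fderiv ℝ g q).comp (ContinuousLinearMap.inl ℝ E ℝ))
      ((hg.fderiv_right le_rfl).clm_comp contDiff_const)

theorem contDiff_integral {E F : Type} [NormedAddCommGroup E] [NormedSpace ℝ E]
    [ProperSpace E] [NormedAddCommGroup F] [NormedSpace ℝ F] {n : ℕ∞} {g : E × ℝ → F}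
    (hg : ContDiff ℝ n g) : ContDiff ℝ n fun x => ∫ s in (0 : ℝ)..1, g (x, s) :=
  contDiff_iff_forall_nat_le.2 fun m hm =>
    contDiff_integral_nat m (hg.of_le (by exact_mod_cast hm))

/-- Hadamard's lemma: `g (v, t) - g (v, 0)` is divisible by `t` among smooth functions. -/
theorem exists_hadamard {V : Type} [NormedAddCommGroup V] [NormedSpace ℝ V] [ProperSpace V]
    {g : V × ℝ → ℝ} (hg : ContDiff ℝ ∞ g) :
    ∃ h : V × ℝ → ℝ, ContDiff ℝ ∞ h ∧ ∀ v t, g (v, t) = g (v, 0) + t * h (v, t) := by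
  have hg' : ContDiff ℝ ∞ (fderiv ℝ g) := hg.fderiv_right (by simp)
  refine ⟨fun q => ∫ s in (0 : ℝ)..1, fderiv ℝ g (q.1, s * q.2) (0, 1), ?_, fun v t => ?_⟩
  · refine contDiff_integral (n := ⊤)
      (g := fun q : (V × ℝ) × ℝ => fderiv ℝ g (q.1.1, q.2 * q.1.2) (0, 1)) ?_
    exact (hg'.comp (by fun_prop)).clm_apply contDiff_const
  · have hd (s : ℝ) : HasDerivAt (fun s : ℝ => g (v, s * t))
        (t * fderiv ℝ g (v, s * t) (0, 1)) s := by
      have h1 : HasDerivAt (fun s : ℝ => (v, s * t)) ((0 : V), t) s :=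
        (hasDerivAt_const s v).prodMk (by simpa using (hasDerivAt_id s).mul_const t)
      have h2 := ((hg.differentiable (by simp)).differentiableAt.hasFDerivAt
        (x := (v, s * t))).comp_hasDerivAt s h1
      have h3 : ((0 : V), t) = t • ((0 : V), (1 : ℝ)) := by simp
      rw [h3, map_smul, smul_eq_mul] at h2
      exact h2
    have hc : Continuous fun s : ℝ => t * fderiv ℝ g (v, s * t) (0, 1) :=
      continuous_const.mul
        ((hg'.continuous.comp (by fun_prop : Continuous fun s : ℝ => (v, s * t))).clm_apply
          continuous_const)
    have := intervalIntegral.integral_eq_sub_of_hasDerivAt (fun s _ => hd s)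
      (hc.intervalIntegrable 0 1)
    rw [intervalIntegral.integral_const_mul] at this
    simp only [one_mul, zero_mul] at this
    simp only [this]
    ring

/-- The primitive of `p` along the last variable that vanishes at `0`, written as an integral over
the fixed interval `[0, 1]`. -/
noncomputable def fiberPrimitive {V : Type} (p : V × ℝ → ℝ) (q : V × ℝ) : ℝ :=
  q.2 * ∫ s in (0 : ℝ)..1, p (q.1, s * q.2)

theorem ContDiff.fiberPrimitive {V : Type} [NormedAddCommGroup V] [NormedSpace ℝ V]
    [ProperSpace V] {n : ℕ∞} {p : V × ℝ → ℝ} (hp : ContDiff ℝ n p) :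
    ContDiff ℝ n (fiberPrimitive p) :=
  contDiff_snd.mul (contDiff_integral (g := fun q : (V × ℝ) × ℝ => p (q.1.1, q.2 * q.1.2))
    (hp.comp (by fun_prop)))

theorem Continuous.fiberPrimitive {V : Type} [NormedAddCommGroup V] [NormedSpace ℝ V]
    [ProperSpace V] {p : V × ℝ → ℝ} (hp : Continuous p) : Continuous (fiberPrimitive p) :=
  contDiff_zero.1 (ContDiff.fiberPrimitive (n := 0) (contDiff_zero.2 hp))

theorem hasDerivAt_fiberPrimitive {V : Type} [TopologicalSpace V] {p : V × ℝ → ℝ}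
    (hp : Continuous p) (v : V) (t : ℝ) :
    HasDerivAt (fun t => fiberPrimitive p (v, t)) (p (v, t)) t := by
  have hc : Continuous fun s : ℝ => p (v, s) := by fun_prop
  have h := intervalIntegral.integral_hasDerivAt_right (hc.intervalIntegrable 0 t)
    (hc.stronglyMeasurableAtFilter _ _) hc.continuousAt
  refine h.congr_of_eventuallyEq (.of_forall fun t => ?_)
  simpa [fiberPrimitive] using intervalIntegral.mul_integral_comp_mul_right (a := 0) (b := 1)
    (f := fun s => p (v, s)) (c := t)

/-! ### Flat functions -/

/-- `g` is smoothly divisible by every power of `z`. For smooth `g` this is equivalent to flatness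
in `z` on the whole space, but it is manifestly stable under smooth operations. -/
def InfDivisible (g : ℝ × ℝ × ℝ → ℝ) : Prop :=
  ∀ M : ℕ, ∃ h : ℝ × ℝ × ℝ → ℝ, ContDiff ℝ ∞ h ∧ ∀ x z w, g (x, z, w) = z ^ M * h (x, z, w)

theorem exists_hadamard_z {g : ℝ × ℝ × ℝ → ℝ} (hg : ContDiff ℝ ∞ g) :
    ∃ h : ℝ × ℝ × ℝ → ℝ, ContDiff ℝ ∞ h ∧
      ∀ x z w, g (x, z, w) = g (x, 0, w) + z * h (x, z, w) := by
  obtain ⟨h, hh, he⟩ := exists_hadamard (V := ℝ × ℝ)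
    (g := fun q => g (q.1.1, q.2, q.1.2)) (hg.comp (by fun_prop))
  exact ⟨fun p => h ((p.1, p.2.2), p.2.1), hh.comp (by fun_prop), fun x z w => he (x, w) z⟩

theorem exists_hadamard_E {g : ℝ × ℝ × ℝ → ℝ} (hg : ContDiff ℝ ∞ g) :
    ∃ h : ℝ × ℝ × ℝ → ℝ, ContDiff ℝ ∞ h ∧
      ∀ x z w, g (x, z, w) = g (x, z, 0) + w * h (x, z, w) := by
  obtain ⟨h, hh, he⟩ := exists_hadamard (V := ℝ × ℝ)
    (g := fun q => g (q.1.1, q.1.2, q.2)) (hg.comp (by fun_prop))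
  exact ⟨fun p => h ((p.1, p.2.1), p.2.2), hh.comp (by fun_prop), fun x z w => he (x, z) w⟩

/-- A continuous function is determined by its product with the variable. -/
theorem eq_of_mul_eq_mul_of_continuous {u v : ℝ → ℝ} (hu : Continuous u) (hv : Continuous v)
    (h : ∀ t, t * u t = t * v t) : u = v := by
  refine hu.ext_on (dense_compl_singleton (0 : ℝ)) hv fun t ht => ?_
  exact mul_left_cancel₀ ht (h t)

theorem InfDivisible.mul_right {g h : ℝ × ℝ × ℝ → ℝ} (hg : InfDivisible g)
    (hh : ContDiff ℝ ∞ h) : InfDivisible fun p => g p * h p := fun M => by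
  obtain ⟨u, hu, he⟩ := hg M
  exact ⟨fun p => u p * h p, hu.mul hh, fun x z w => by simp only [he]; ring⟩

theorem InfDivisible.add {g h : ℝ × ℝ × ℝ → ℝ} (hg : InfDivisible g)
    (hh : InfDivisible h) : InfDivisible fun p => g p + h p := fun M => by
  obtain ⟨u, hu, he⟩ := hg M
  obtain ⟨v, hv, he'⟩ := hh M
  exact ⟨fun p => u p + v p, hu.add hv, fun x z w => by simp only [he, he']; ring⟩

theorem InfDivisible.eq_zero {g : ℝ × ℝ × ℝ → ℝ} (hg : InfDivisible g) (x w : ℝ) :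
    g (x, 0, w) = 0 := by
  obtain ⟨u, -, he⟩ := hg 1
  simp [he]

theorem InfDivisible.div_z {g h : ℝ × ℝ × ℝ → ℝ} (hg : InfDivisible g) (hh : ContDiff ℝ ∞ h)
    (he : ∀ x z w, g (x, z, w) = z * h (x, z, w)) : InfDivisible h := fun M => by
  obtain ⟨u, hu, hu'⟩ := hg (M + 1)
  refine ⟨u, hu, fun x z w => ?_⟩
  refine congrFun (eq_of_mul_eq_mul_of_continuous (u := fun z => h (x, z, w))
    (v := fun z => z ^ M * u (x, z, w)) (hh.continuous.comp (by fun_prop))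
    ((continuous_pow M).mul (hu.continuous.comp (by fun_prop))) fun t => ?_) z
  rw [← he, hu']
  ring

/-- Infinite divisibility passes to the difference quotient in the last variable. -/
theorem InfDivisible.div_E {g h : ℝ × ℝ × ℝ → ℝ} (hg : InfDivisible g) (hh : ContDiff ℝ ∞ h)
    (he : ∀ x z w, g (x, z, w) = g (x, z, 0) + w * h (x, z, w)) : InfDivisible h := fun M => by
  obtain ⟨u, hu, hu'⟩ := hg M
  obtain ⟨v, hv, hv'⟩ := exists_hadamard_E hu
  refine ⟨v, hv, fun x z w => ?_⟩
  refine congrFun (eq_of_mul_eq_mul_of_continuous (u := fun w => h (x, z, w))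
    (v := fun w => z ^ M * v (x, z, w)) (hh.continuous.comp (by fun_prop))
    (continuous_const.mul (hv.continuous.comp (by fun_prop))) fun t => ?_) w
  have h1 := he x z t
  rw [hu', hu' x z 0, hv'] at h1
  linarith

/-- A smooth function that is flat in `z` in the sense of pointwise decay is infinitely divisible
by `z`: a smooth quotient by `z` exists by Hadamard's lemma and is again flat. -/
theorem FlatInZ.infDivisible {g : ℝ × ℝ × ℝ → ℝ} (hf : FlatInZ g univ) (hg : ContDiff ℝ ∞ g) :
    InfDivisible g := by
  intro M
  induction M generalizing g with
  | zero => exact ⟨g, hg, by simp⟩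
  | succ M ih =>
    have h0 (x w : ℝ) : g (x, 0, w) = 0 := by
      have h1 := (hf x w (mem_univ _) 1).eq_zero_imp.self_of_nhds
      simpa using h1
    obtain ⟨h, hh, he⟩ := exists_hadamard_z hg
    have hflat : FlatInZ h univ := by
      intro x w _ m
      have hc : Continuous fun z => h (x, z, w) := hh.continuous.comp (by fun_prop)
      obtain ⟨C, hC⟩ := (hf x w (mem_univ _) (m + 1)).bound
      refine Asymptotics.IsBigO.of_bound C ?_
      obtain ⟨ε, hε, hball⟩ := Metric.eventually_nhds_iff.1 hC
      have hne : ∀ z : ℝ, |z| < ε → z ≠ 0 → ‖h (x, z, w)‖ ≤ C * ‖z ^ m‖ := by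
        intro z hz hz0
        have h1 := hball (y := z) (by simpa using hz)
        rw [he, h0, zero_add, norm_mul, pow_succ, norm_mul] at h1
        have hp : 0 < ‖z‖ := norm_pos_iff.2 hz0
        nlinarith
      filter_upwards [Metric.ball_mem_nhds (0 : ℝ) hε] with z hz
      by_cases hz0 : z = 0
      · subst hz0
        have hl : Tendsto (fun z => ‖h (x, z, w)‖) (𝓝[≠] 0) (𝓝 ‖h (x, 0, w)‖) :=
          (hc.norm.tendsto 0).mono_left nhdsWithin_le_nhds
        have hr : Tendsto (fun z : ℝ => C * ‖z ^ m‖) (𝓝[≠] 0) (𝓝 (C * ‖(0 : ℝ) ^ m‖)) :=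
          ((by fun_prop : Continuous fun z : ℝ => C * ‖z ^ m‖).tendsto 0).mono_left
            nhdsWithin_le_nhds
        refine le_of_tendsto_of_tendsto hl hr ?_
        filter_upwards [self_mem_nhdsWithin,
          mem_nhdsWithin_of_mem_nhds (Metric.ball_mem_nhds (0 : ℝ) hε)] with z h1 h2
        exact hne z (by simpa using h2) h1
      · exact hne z (by simpa using hz) hz0
    obtain ⟨u, hu, hu'⟩ := ih hflat hh
    exact ⟨u, hu, fun x z w => by rw [he, h0, hu']; ring⟩

/-! ### The flow of a scalar equation depending on a parameter -/

/-- A bounded Lipschitz `C¹` vector field on the line is complete. -/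
theorem exists_global_solution {v : ℝ → ℝ} (hv : ContDiff ℝ 1 v) {K C : NNReal}
    (hK : LipschitzWith K v) (hC : ∀ x, ‖v x‖ ≤ C) (x : ℝ) :
    ∃ γ : ℝ → ℝ, γ 0 = x ∧ ∀ t, HasDerivAt γ (v (γ t)) t := by
  have hloc (x : ℝ) : ∃ γ : ℝ → ℝ, γ 0 = x ∧ ∀ t ∈ Ioo (-1 : ℝ) 1, HasDerivAt γ (v (γ t)) t := by
    have hPL : IsPicardLindelof (fun _ => v) (tmin := -1) (tmax := 1)
        ⟨0, by norm_num, by norm_num⟩ x C 0 C K := by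
      refine IsPicardLindelof.of_time_independent (fun y _ => hC y) hK.lipschitzOnWith ?_
      simp
    obtain ⟨γ, h0, hγ⟩ := hPL.exists_eq_forall_mem_Icc_hasDerivWithinAt₀
    exact ⟨γ, h0, fun t ht => (hγ t (Ioo_subset_Icc_self ht)).hasDerivAt
      (Icc_mem_nhds ht.1 ht.2)⟩
  have hv' : ContMDiff (modelWithCornersSelf ℝ ℝ) (modelWithCornersSelf ℝ ℝ).tangent 1
      (fun x => (⟨x, v x⟩ : TangentBundle (modelWithCornersSelf ℝ ℝ) ℝ)) :=
    contMDiff_vectorSpace_iff_contDiff.2 hv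
  obtain ⟨γ, h0, hγ⟩ := exists_isMIntegralCurve_of_isMIntegralCurveOn
    (I := modelWithCornersSelf ℝ ℝ) hv' one_pos (fun x => by
      obtain ⟨γ, h0, hγ⟩ := hloc x
      exact ⟨γ, h0, fun t ht => (hγ t ht).hasFDerivAt.hasMFDerivAt.hasMFDerivWithinAt⟩) x
  exact ⟨γ, h0, fun t => by
    have h := (hγ t).hasFDerivAt
    rw [hasDerivAt_iff_hasFDerivAt]
    exact h⟩

theorem dist_flow_le_of_nonneg {f : ℝ × ℝ → ℝ} {K : NNReal} (hK : LipschitzWith K f)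
    {φ : (ℝ × ℝ) × ℝ → ℝ} (h0 : ∀ v, φ (v, 0) = v.1)
    (hd : ∀ v t, HasDerivAt (fun t => φ (v, t)) (f (φ (v, t), v.2)) t)
    (v w : ℝ × ℝ) {t : ℝ} (ht : 0 ≤ t) :
    dist (φ (v, t)) (φ (w, t)) ≤ dist v w * Real.exp (K * t) := by
  -- the parameter becomes a second, constant, component of the trajectory
  have hd' (v : ℝ × ℝ) (t : ℝ) :
      HasDerivAt (fun t => (φ (v, t), v.2)) (f (φ (v, t), v.2), (0 : ℝ)) t :=
    (hd v t).prodMk (hasDerivAt_const t v.2)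
  have hLip : LipschitzWith K fun u : ℝ × ℝ => (f u, (0 : ℝ)) := by
    refine LipschitzWith.of_dist_le_mul fun a b => ?_
    simpa [Prod.dist_eq] using hK.dist_le_mul a b
  have := dist_le_of_trajectories_ODE (v := fun _ u => (f u, (0 : ℝ))) (fun _ => hLip)
    (f := fun t => (φ (v, t), v.2)) (g := fun t => (φ (w, t), w.2)) (a := 0) (b := t)
    (δ := dist v w)
    (fun s _ => (hd' v s).continuousAt.continuousWithinAt)
    (fun s _ => (hd' v s).hasDerivWithinAt)
    (fun s _ => (hd' w s).continuousAt.continuousWithinAt)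
    (fun s _ => (hd' w s).hasDerivWithinAt) (by simp [h0]) t ⟨ht, le_rfl⟩
  rw [sub_zero] at this
  exact (le_max_left _ _).trans this

theorem dist_flow_le {f : ℝ × ℝ → ℝ} {K : NNReal} (hK : LipschitzWith K f)
    {φ : (ℝ × ℝ) × ℝ → ℝ} (h0 : ∀ v, φ (v, 0) = v.1)
    (hd : ∀ v t, HasDerivAt (fun t => φ (v, t)) (f (φ (v, t), v.2)) t)
    (v w : ℝ × ℝ) (t : ℝ) :
    dist (φ (v, t)) (φ (w, t)) ≤ dist v w * Real.exp (K * |t|) := by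
  rcases le_total 0 t with ht | ht
  · rw [abs_of_nonneg ht]
    exact dist_flow_le_of_nonneg hK h0 hd v w ht
  · -- time reversal
    have := dist_flow_le_of_nonneg (f := fun u => -f u) (φ := fun q => φ (q.1, -q.2)) hK.neg
      (by simpa using h0) (fun v t => by
        have h := (hd v (-t)).scomp t (hasDerivAt_neg t)
        rw [neg_one_smul] at h
        exact h)
      v w (t := -t) (by linarith)
    simpa [abs_of_nonpos ht] using this

theorem continuous_flow {f : ℝ × ℝ → ℝ} {K : NNReal} (hK : LipschitzWith K f)
    {φ : (ℝ × ℝ) × ℝ → ℝ} (h0 : ∀ v, φ (v, 0) = v.1)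
    (hd : ∀ v t, HasDerivAt (fun t => φ (v, t)) (f (φ (v, t), v.2)) t) : Continuous φ := by
  refine continuous_iff_continuousAt.2 fun q => ?_
  rw [ContinuousAt, tendsto_iff_dist_tendsto_zero]
  have hφ : Continuous fun t => φ (q.1, t) :=
    continuous_iff_continuousAt.2 fun t => (hd q.1 t).continuousAt
  have hb : Continuous fun p : (ℝ × ℝ) × ℝ =>
      dist p.1 q.1 * Real.exp (K * |p.2|) + dist (φ (q.1, p.2)) (φ (q.1, q.2)) :=
    ((by fun_prop : Continuous fun p : (ℝ × ℝ) × ℝ => dist p.1 q.1 * Real.exp (K * |p.2|))).add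
      ((hφ.comp continuous_snd).dist continuous_const)
  refine squeeze_zero (fun _ => dist_nonneg) (fun p => ?_) (by simpa using hb.tendsto q)
  exact (dist_triangle _ (φ (q.1, p.2)) _).trans
    (add_le_add_left (dist_flow_le hK h0 hd p.1 q.1 p.2) _)

/-- Variation of constants for a scalar linear equation `D' = A D + c B`, where `I` and `J` are
primitives of `A` and of `exp (-I) B`. -/
theorem eq_of_linear_ode {D A B I J : ℝ → ℝ} {c : ℝ}
    (hD : ∀ t, HasDerivAt D (A t * D t + c * B t) t) (hI : ∀ t, HasDerivAt I (A t) t)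
    (hJ : ∀ t, HasDerivAt J (Real.exp (-I t) * B t) t) (hI0 : I 0 = 0) (hJ0 : J 0 = 0) (t : ℝ) :
    D t = Real.exp (I t) * (D 0 + c * J t) := by
  have hW (t : ℝ) : HasDerivAt (fun t => Real.exp (-I t) * D t - c * J t) 0 t := by
    refine (((hI t).neg.exp.mul (hD t)).sub ((hJ t).const_mul c)).congr_deriv ?_
    simp only [Pi.neg_apply]
    ring
  have h := is_const_of_deriv_eq_zero (fun t => (hW t).differentiableAt) (fun t => (hW t).deriv) t 0
  simp only [hI0, hJ0, neg_zero, Real.exp_zero, one_mul, mul_zero, sub_zero] at h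
  rw [← h, sub_add_cancel, ← mul_assoc, ← Real.exp_add]
  simp

theorem hasFDerivAt_mul_of_eq_zero {E : Type*} [NormedAddCommGroup E] [NormedSpace ℝ E]
    {l c : E → ℝ} {l' : E →L[ℝ] ℝ} {a : E} (hl : HasFDerivAt l l' a) (h0 : l a = 0)
    (hc : ContinuousAt c a) : HasFDerivAt (fun p => l p * c p) (c a • l') a := by
  rw [hasFDerivAt_iff_isLittleO] at hl ⊢
  have h1 : (fun p => (l p - l a - l' (p - a)) * c p) =o[𝓝 a] fun p => p - a := by
    have := hl.norm_right.mul_isBigO (hc.isBigO_one ℝ)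
    simpa using this
  have h2 : (fun p => l' (p - a) * (c p - c a)) =o[𝓝 a] fun p => p - a := by
    have hc' : (fun p => c p - c a) =o[𝓝 a] fun _ => (1 : ℝ) := by
      rw [Asymptotics.isLittleO_one_iff]
      simpa using hc.tendsto.sub_const (c a)
    have := (l'.isBigO_sub (𝓝 a) a).norm_right.mul_isLittleO hc'
    simpa using this
  refine (h1.add h2).congr_left fun p => ?_
  simp [h0]
  ring

/-- The derivative of the flow: the difference of two solutions solves a linear equation with
continuous coefficients, whose solution formula exhibits the partial derivatives. They are
as smooth as the flow itself, so that smoothness can be bootstrapped. -/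
theorem exists_hasFDerivAt_flow {f : ℝ × ℝ → ℝ} (hf : ContDiff ℝ ∞ f)
    {φ : (ℝ × ℝ) × ℝ → ℝ} (h0 : ∀ v, φ (v, 0) = v.1)
    (hd : ∀ v t, HasDerivAt (fun t => φ (v, t)) (f (φ (v, t), v.2)) t) (hφ : Continuous φ) :
    ∃ φ' : (ℝ × ℝ) × ℝ → ((ℝ × ℝ) × ℝ →L[ℝ] ℝ), (∀ q, HasFDerivAt φ (φ' q) q) ∧
      (∀ q, 0 < φ' q ((1, 0), 0)) ∧ ∀ n : ℕ, ContDiff ℝ n φ → ContDiff ℝ n φ' := by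
  obtain ⟨h₁, hh₁, he₁⟩ := exists_hadamard (V := ℝ × ℝ) (g := fun q => f (q.1.1 + q.2, q.1.2))
    (hf.comp (by fun_prop))
  obtain ⟨h₂, hh₂, he₂⟩ := exists_hadamard (V := ℝ × ℝ) (g := fun q => f (q.1.1, q.1.2 + q.2))
    (hf.comp (by fun_prop))
  have hdiff (u v ε μ : ℝ) : f (u, ε) - f (v, μ) =
      h₁ ((v, ε), u - v) * (u - v) + (ε - μ) * h₂ ((v, μ), ε - μ) := by
    have e1 := he₁ (v, ε) (u - v)
    have e2 := he₂ (v, μ) (ε - μ)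
    simp only [add_sub_cancel, add_zero] at e1 e2
    linarith
  let I : (ℝ × ℝ) × ℝ → ℝ := fiberPrimitive fun q => h₁ ((φ q, q.1.2), 0)
  let J : (ℝ × ℝ) × ℝ → ℝ := fiberPrimitive fun q => Real.exp (-I q) * h₂ ((φ q, q.1.2), 0)
  refine ⟨fun q => f (φ q, q.1.2) • ContinuousLinearMap.snd ℝ (ℝ × ℝ) ℝ +
    Real.exp (I q) • (ContinuousLinearMap.fst ℝ ℝ ℝ).comp (ContinuousLinearMap.fst ℝ (ℝ × ℝ) ℝ) +
    (Real.exp (I q) * J q) •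
      (ContinuousLinearMap.snd ℝ ℝ ℝ).comp (ContinuousLinearMap.fst ℝ (ℝ × ℝ) ℝ), ?_,
    fun q => by simp [Real.exp_pos], ?_⟩
  · rintro ⟨w, t₀⟩
    have hc₁ := hh₁.continuous
    have hc₂ := hh₂.continuous
    let A : (ℝ × ℝ) × ℝ → ℝ := fun p => h₁ ((φ (w, p.2), p.1.2), φ p - φ (w, p.2))
    let B : (ℝ × ℝ) × ℝ → ℝ := fun p => h₂ ((φ (w, p.2), w.2), p.1.2 - w.2)
    have hA : Continuous A := by fun_prop
    have hB : Continuous B := by fun_prop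
    have hIc : Continuous (fiberPrimitive A) := Continuous.fiberPrimitive hA
    let B' : (ℝ × ℝ) × ℝ → ℝ := fun p => Real.exp (-fiberPrimitive A p) * B p
    have hB' : Continuous B' := by fun_prop
    have hJc : Continuous (fiberPrimitive B') := Continuous.fiberPrimitive hB'
    have hIw (t : ℝ) : fiberPrimitive A (w, t) = I (w, t) := by
      simp [I, A, fiberPrimitive]
    have hJw (t : ℝ) : fiberPrimitive B' (w, t) = J (w, t) := by
      simp only [J, fiberPrimitive, B', B]
      simp only [← hIw, sub_self]
      rfl
    have key (p : (ℝ × ℝ) × ℝ) : φ p = φ (w, p.2) +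
        (p.1.1 - w.1) * Real.exp (fiberPrimitive A p) +
        (p.1.2 - w.2) * (Real.exp (fiberPrimitive A p) * fiberPrimitive B' p) := by
      obtain ⟨v, t⟩ := p
      have := eq_of_linear_ode (D := fun t => φ (v, t) - φ (w, t)) (A := fun t => A (v, t))
        (B := fun t => B (v, t)) (I := fun t => fiberPrimitive A (v, t))
        (J := fun t => fiberPrimitive B' (v, t)) (c := v.2 - w.2)
        (fun t => by
          have := (hd v t).sub (hd w t)
          rw [hdiff] at this
          exact this)
        (fun t => hasDerivAt_fiberPrimitive hA v t)
        (fun t => hasDerivAt_fiberPrimitive hB' v t)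
        (by simp [fiberPrimitive]) (by simp [fiberPrimitive]) t
      simp only [h0] at this
      linear_combination this
    have d1 : HasFDerivAt (fun p : (ℝ × ℝ) × ℝ => φ (w, p.2))
        (f (φ (w, t₀), w.2) • ContinuousLinearMap.snd ℝ (ℝ × ℝ) ℝ) (w, t₀) :=
      (hd w t₀).comp_hasFDerivAt (w, t₀) (f := fun p : (ℝ × ℝ) × ℝ => p.2) hasFDerivAt_snd
    have d2 := hasFDerivAt_mul_of_eq_zero
      (((hasFDerivAt_fst (𝕜 := ℝ) (p := w)).comp (w, t₀) (hasFDerivAt_fst (F := ℝ))).sub_const w.1)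
      (c := fun p => Real.exp (fiberPrimitive A p)) (by simp) (by fun_prop)
    have d3 := hasFDerivAt_mul_of_eq_zero
      (((hasFDerivAt_snd (𝕜 := ℝ) (p := w)).comp (w, t₀) (hasFDerivAt_fst (F := ℝ))).sub_const w.2)
      (c := fun p => Real.exp (fiberPrimitive A p) * fiberPrimitive B' p) (by simp) (by fun_prop)
    have d := (d1.add d2).add d3
    rw [hIw, hJw] at d
    exact d.congr_of_eventuallyEq (.of_forall key)
  · intro n hn
    have hf' : ContDiff ℝ n f := hf.of_le (by exact_mod_cast le_top)
    have hh₁' : ContDiff ℝ n h₁ := hh₁.of_le (by exact_mod_cast le_top)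
    have hh₂' : ContDiff ℝ n h₂ := hh₂.of_le (by exact_mod_cast le_top)
    have hI : ContDiff ℝ n I := ContDiff.fiberPrimitive (n := n)
      (hh₁'.comp (f := fun q : (ℝ × ℝ) × ℝ => ((φ q, q.1.2), (0 : ℝ))) (by fun_prop))
    have hJ : ContDiff ℝ n J := ContDiff.fiberPrimitive (n := n) (hI.neg.exp.mul
      (hh₂'.comp (f := fun q : (ℝ × ℝ) × ℝ => ((φ q, q.1.2), (0 : ℝ))) (by fun_prop)))
    have hfφ : ContDiff ℝ n fun q : (ℝ × ℝ) × ℝ => f (φ q, q.1.2) := hf'.comp (by fun_prop)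
    exact ((hfφ.smul contDiff_const).add (hI.exp.smul contDiff_const)).add
      ((hI.exp.mul hJ).smul contDiff_const)

/-- A smooth compactly supported equation `u' = f (u, ε)` has a smooth global flow
`φ ((x, ε), t)`, increasing in the initial value `x`. -/
theorem exists_smooth_flow {f : ℝ × ℝ → ℝ} (hf : ContDiff ℝ ∞ f) (hs : HasCompactSupport f) :
    ∃ φ : (ℝ × ℝ) × ℝ → ℝ, ContDiff ℝ ∞ φ ∧ (∀ v, φ (v, 0) = v.1) ∧
      (∀ v t, HasDerivAt (fun t => φ (v, t)) (f (φ (v, t), v.2)) t) ∧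
      (∀ q, 0 < fderiv ℝ φ q ((1, 0), 0)) ∧
      ∀ x ε s t, φ ((φ ((x, ε), t), ε), s) = φ ((x, ε), t + s) := by
  obtain ⟨K, hK⟩ := hf.lipschitzWith_of_hasCompactSupport hs (by simp)
  obtain ⟨C, hC⟩ := hs.exists_bound_of_continuous hf.continuous
  have hsol (v : ℝ × ℝ) : ∃ γ : ℝ → ℝ, γ 0 = v.1 ∧ ∀ t, HasDerivAt γ (f (γ t, v.2)) t := by
    refine exists_global_solution (v := fun u => f (u, v.2)) (K := K) (C := C.toNNReal)
      ((hf.comp (by fun_prop : ContDiff ℝ ∞ fun u : ℝ => (u, v.2))).of_le (by simp)) ?_ ?_ v.1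
    · exact LipschitzWith.of_dist_le_mul fun a b => by
        simpa [Prod.dist_eq] using hK.dist_le_mul (a, v.2) (b, v.2)
    · exact fun u => (hC _).trans (Real.le_coe_toNNReal C)
  choose γ h0 hd using hsol
  let φ : (ℝ × ℝ) × ℝ → ℝ := fun q => γ q.1 q.2
  have hcont : Continuous φ := continuous_flow hK h0 hd
  obtain ⟨φ', hφ', hpos, hsm⟩ := exists_hasFDerivAt_flow hf (φ := φ) h0 hd hcont
  refine ⟨φ, ?_, h0, hd, fun q => (hφ' q).fderiv ▸ hpos q, fun x ε s t => ?_⟩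
  · refine contDiff_infty.2 fun n => ?_
    induction n with
    | zero => exact contDiff_zero.2 hcont
    | succ n ih =>
      push_cast
      exact contDiff_succ_iff_hasFDerivAt.2 ⟨φ', hsm n ih, hφ'⟩
  · have huniq : γ (γ (x, ε) t, ε) = fun s => γ (x, ε) (t + s) := by
      refine ODE_solution_unique_univ (v := fun _ u => f (u, ε)) (s := fun _ => univ) (K := K)
        (t₀ := 0) (fun _ => LipschitzWith.lipschitzOnWith <|
          LipschitzWith.of_dist_le_mul fun a b => by
            simpa [Prod.dist_eq] using hK.dist_le_mul (a, ε) (b, ε))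
        (fun s => ⟨hd _ s, mem_univ _⟩) (fun s => ⟨?_, mem_univ _⟩) (by simp [h0])
      exact (hd (x, ε) (t + s)).comp_const_add t s
    exact congrFun huniq s

/-! ### Elimination of the non-resonant terms -/

theorem hasFDerivAt_snd_fst (p : ℝ × ℝ × ℝ) : HasFDerivAt (fun p : ℝ × ℝ × ℝ => p.2.1)
    ((ContinuousLinearMap.fst ℝ ℝ ℝ).comp (ContinuousLinearMap.snd ℝ ℝ (ℝ × ℝ))) p :=
  hasFDerivAt_fst.comp p hasFDerivAt_snd

theorem hasFDerivAt_snd_snd (p : ℝ × ℝ × ℝ) : HasFDerivAt (fun p : ℝ × ℝ × ℝ => p.2.2)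
    ((ContinuousLinearMap.snd ℝ ℝ ℝ).comp (ContinuousLinearMap.snd ℝ ℝ (ℝ × ℝ))) p :=
  hasFDerivAt_snd.comp p hasFDerivAt_snd

/-- The function `(zE) ^ n` is a first integral, so it is a constant for the derivation along the
vector field. -/
theorem fderiv_eps_pow_mul {T : ℝ × ℝ × ℝ → ℝ} (hT : ContDiff ℝ ∞ T) (n : ℕ) (x z w c : ℝ) :
    fderiv ℝ (fun p => (p.2.1 * p.2.2) ^ n * T p) (x, z, w) (c, -z, w) =
      (z * w) ^ n * fderiv ℝ T (x, z, w) (c, -z, w) := by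
  have h := (((hasFDerivAt_snd_fst (x, z, w)).mul (hasFDerivAt_snd_snd (x, z, w))).pow n).mul
    ((hT.differentiable (by simp)).differentiableAt (x := (x, z, w))).hasFDerivAt
  refine (congrArg (fun l => l (c, -z, w)) h.fderiv).trans ?_
  simp
  ring

theorem fderiv_sub_apply_hyperbolic {P Q p q : ℝ × ℝ → ℝ} (hP : ContDiff ℝ ∞ P)
    (hQ : ContDiff ℝ ∞ Q) (hp : ∀ v t, HasDerivAt (fun t => P (v, t)) (p (v, t)) t)
    (hq : ∀ v t, HasDerivAt (fun t => Q (v, t)) (q (v, t)) t) (x z w c : ℝ) :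
    fderiv ℝ (fun p : ℝ × ℝ × ℝ => P (p.1, p.2.1) - Q (p.1, p.2.2)) (x, z, w) (c, -z, w) =
      c * fderiv ℝ (fun p : ℝ × ℝ × ℝ => P (p.1, p.2.1) - Q (p.1, p.2.2)) (x, z, w) (1, 0, 0)
        - z * p (x, z) - w * q (x, w) := by
  set T : ℝ × ℝ × ℝ → ℝ := fun p => P (p.1, p.2.1) - Q (p.1, p.2.2) with hTdef
  have hT : ContDiff ℝ ∞ T := (hP.comp (by fun_prop)).sub (hQ.comp (by fun_prop))
  have hv : ((c, -z, w) : ℝ × ℝ × ℝ) = c • (1, 0, 0) + (0, -z, w) := by simp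
  have h0 : fderiv ℝ T (x, z, w) (0, -z, w) = -(z * p (x, z)) - w * q (x, w) := by
    have hz : HasDerivAt (fun s : ℝ => z + s * -z) (-z) 0 := by
      simpa using ((hasDerivAt_id (0 : ℝ)).mul_const (-z)).const_add z
    have hw : HasDerivAt (fun s : ℝ => w + s * w) w 0 := by
      simpa using ((hasDerivAt_id (0 : ℝ)).mul_const w).const_add w
    have h1 : HasDerivAt (fun s : ℝ => T (x, z + s * -z, w + s * w))
        (fderiv ℝ T (x, z, w) (0, -z, w)) 0 := by
      refine HasFDerivAt.comp_hasDerivAt (l := T) (f := fun s : ℝ => (x, z + s * -z, w + s * w))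
        (0 : ℝ) ?_ ((hasDerivAt_const (0 : ℝ) x).prodMk (hz.prodMk hw))
      simpa using ((hT.differentiable (by simp)).differentiableAt (x := (x, z, w))).hasFDerivAt
    have h2 : HasDerivAt (fun s : ℝ => P (x, z + s * -z)) (p (x, z) * -z) 0 :=
      HasDerivAt.comp (h₂ := fun t => P (x, t)) (0 : ℝ) (by simpa using hp x z) hz
    have h3 : HasDerivAt (fun s : ℝ => Q (x, w + s * w)) (q (x, w) * w) 0 :=
      HasDerivAt.comp (h₂ := fun t => Q (x, t)) (0 : ℝ) (by simpa using hq x w) hw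
    rw [h1.unique (h2.sub h3)]
    ring
  rw [hv, map_add, map_smul, h0, smul_eq_mul]
  ring

/-- A smooth function of `(x, z, E)` is the sum of a function of `x`, multiples of `z` and of `E`
that depend only on `(x, z)` and on `(x, E)`, and a multiple of `zE`. -/
theorem exists_resonance_splitting {b : ℝ × ℝ × ℝ → ℝ} (hb : ContDiff ℝ ∞ b) :
    ∃ (p q : ℝ × ℝ → ℝ) (r : ℝ × ℝ × ℝ → ℝ), ContDiff ℝ ∞ p ∧ ContDiff ℝ ∞ q ∧ ContDiff ℝ ∞ r ∧
      (∀ x z w, b (x, z, w) = b (x, 0, 0) + z * p (x, z) + w * q (x, w) + z * w * r (x, z, w)) ∧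
      (InfDivisible b → InfDivisible r) := by
  obtain ⟨p, hp, hpe⟩ := exists_hadamard (V := ℝ) (g := fun v => b (v.1, v.2, 0))
    (hb.comp (by fun_prop))
  obtain ⟨h, hh, hhe⟩ := exists_hadamard_E hb
  obtain ⟨r, hr, hre⟩ := exists_hadamard_z hh
  refine ⟨p, fun v => h (v.1, 0, v.2), r, hp, hh.comp (by fun_prop), hr, fun x z w => ?_,
    fun hflat => ?_⟩
  · have h1 := hpe x z
    have h2 := hhe x z w
    have h3 := hre x z w
    simp only at h1
    rw [h2, h3, h1]
    ring
  · have hf := hflat.div_E hh hhe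
    exact hf.div_z hr fun x z w => by rw [hre, hf.eq_zero, zero_add]

/-- Normal form, up to order `ε ^ n` with `ε = zE`, of the equation `x' = ε g(x, z, E)` together
with `z' = -z`, `E' = E`: the new coordinate is `S = x + ε R`. Both sides of
`S' = ε a + ε ^ (n + 1) b` are divided by `ε`. The step removes from the remainder its
terms `z p(x, z)` and `E q(x, E)`, which lie in the image of the derivation `-z ∂_z + E ∂_E`, and
puts its value at `z = E = 0` into `a`. -/
theorem exists_normal_form {g : ℝ × ℝ × ℝ → ℝ} (hg : ContDiff ℝ ∞ g) (n : ℕ) :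
    ∃ (R : ℝ × ℝ × ℝ → ℝ) (a : ℝ × ℝ → ℝ) (b : ℝ × ℝ × ℝ → ℝ),
      ContDiff ℝ ∞ R ∧ ContDiff ℝ ∞ a ∧ ContDiff ℝ ∞ b ∧
      (∀ x z w, g (x, z, w) + fderiv ℝ R (x, z, w) (z * w * g (x, z, w), -z, w) =
        a (x + z * w * R (x, z, w), z * w) + (z * w) ^ n * b (x, z, w)) ∧
      (InfDivisible g → a = 0 ∧ InfDivisible b) := by
  induction n with
  | zero =>
    exact ⟨fun _ => 0, 0, g, contDiff_const, contDiff_const, hg, by simp, fun h => ⟨rfl, h⟩⟩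
  | succ n ih =>
    obtain ⟨R, a, b, hR, ha, hb, he, hflat⟩ := ih
    obtain ⟨p, q, r, hp, hq, hr, hbe, hrflat⟩ := exists_resonance_splitting hb
    let P := fiberPrimitive p
    let Q := fiberPrimitive q
    have hP : ContDiff ℝ ∞ P := ContDiff.fiberPrimitive hp
    have hQ : ContDiff ℝ ∞ Q := ContDiff.fiberPrimitive hq
    let T : ℝ × ℝ × ℝ → ℝ := fun p => P (p.1, p.2.1) - Q (p.1, p.2.2)
    have hT : ContDiff ℝ ∞ T := (hP.comp (by fun_prop)).sub (hQ.comp (by fun_prop))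
    let R' : ℝ × ℝ × ℝ → ℝ := fun p => R p + (p.2.1 * p.2.2) ^ n * T p
    have hR' : ContDiff ℝ ∞ R' := by fun_prop
    let S' : ℝ × ℝ × ℝ → ℝ := fun p => p.1 + p.2.1 * p.2.2 * R' p
    have hS' : ContDiff ℝ ∞ S' := by fun_prop
    -- Taylor remainders for expressing `a` and the resonant term in the new coordinate
    obtain ⟨A, hA, hAe⟩ := exists_hadamard (V := ℝ × ℝ) (g := fun v => a (v.1.1 + v.2, v.1.2))
      (ha.comp (by fun_prop))
    obtain ⟨C, hC, hCe⟩ := exists_hadamard (V := ℝ) (g := fun v => b (v.1 + v.2, 0, 0))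
      (hb.comp (by fun_prop))
    have hTx : ContDiff ℝ ∞ fun p => fderiv ℝ T p (1, 0, 0) :=
      (hT.fderiv_right (m := ∞) (by simp)).clm_apply contDiff_const
    refine ⟨R', fun v => a v + v.2 ^ n * b (v.1, 0, 0),
      fun p => r p + g p * fderiv ℝ T p (1, 0, 0)
        - T p * A ((S' p, p.2.1 * p.2.2), -((p.2.1 * p.2.2) ^ (n + 1) * T p))
        - R' p * C (S' p, -(p.2.1 * p.2.2 * R' p)), hR', ?_, ?_, fun x z w => ?_, fun hgf => ?_⟩
    · exact ha.add ((contDiff_snd.pow n).mul (hb.comp (by fun_prop)))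
    · refine ((hr.add (hg.mul hTx)).sub (hT.mul (hA.comp ?_))).sub (hR'.mul (hC.comp ?_)) <;>
        fun_prop
    · have hX : fderiv ℝ R' (x, z, w) (z * w * g (x, z, w), -z, w) =
          fderiv ℝ R (x, z, w) (z * w * g (x, z, w), -z, w) + (z * w) ^ n *
            (z * w * g (x, z, w) * fderiv ℝ T (x, z, w) (1, 0, 0)
              - z * p (x, z) - w * q (x, w)) := by
        have hεT : ContDiff ℝ ∞ fun p : ℝ × ℝ × ℝ => (p.2.1 * p.2.2) ^ n * T p := by fun_prop
        have h1 : fderiv ℝ R' (x, z, w) = fderiv ℝ R (x, z, w) +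
            fderiv ℝ (fun p => (p.2.1 * p.2.2) ^ n * T p) (x, z, w) :=
          fderiv_fun_add (hR.differentiable (by simp)).differentiableAt
            (hεT.differentiable (by simp)).differentiableAt
        rw [h1, add_apply, fderiv_eps_pow_mul hT,
          fderiv_sub_apply_hyperbolic hP hQ (fun v t => hasDerivAt_fiberPrimitive hp.continuous v t)
            (fun v t => hasDerivAt_fiberPrimitive hq.continuous v t)]
      have h1 := hAe (S' (x, z, w), z * w) (-((z * w) ^ (n + 1) * T (x, z, w)))
      have h2 := hCe (S' (x, z, w)) (-(z * w * R' (x, z, w)))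
      have h3 : S' (x, z, w) + -((z * w) ^ (n + 1) * T (x, z, w)) = x + z * w * R (x, z, w) := by
        simp only [S', R']
        ring
      have h4 : S' (x, z, w) + -(z * w * R' (x, z, w)) = x := by
        simp only [S']
        ring
      have h5 : x + z * w * R' (x, z, w) = S' (x, z, w) := rfl
      simp only [h3, h4, add_zero] at h1 h2
      have h6 := he x z w
      have h7 := hbe x z w
      rw [h1, h7, h2] at h6
      rw [hX, h5]
      simp only
      linear_combination h6
    · obtain ⟨ha0, hbf⟩ := hflat hgf
      have hb0 (x : ℝ) : b (x, 0, 0) = 0 := hbf.eq_zero x 0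
      have hA0 (v : ℝ × ℝ) (t : ℝ) : A (v, t) = 0 :=
        congrFun (eq_of_mul_eq_mul_of_continuous (u := fun t => A (v, t)) (v := fun _ => 0)
          (hA.continuous.comp (by fun_prop)) continuous_const fun t => by
            have := hAe v t
            simp only [ha0, Pi.zero_apply] at this
            linarith) t
      have hC0 (v t : ℝ) : C (v, t) = 0 :=
        congrFun (eq_of_mul_eq_mul_of_continuous (u := fun t => C (v, t)) (v := fun _ => 0)
          (hC.continuous.comp (by fun_prop)) continuous_const fun t => by
            have := hCe v t
            simp only [hb0] at this
            linarith) t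
      refine ⟨?_, ?_⟩
      · funext v
        simp [ha0, hb0]
      · simp only [hA0, hC0, mul_zero, sub_zero]
        exact (hrflat hbf).add (hgf.mul_right hTx)

/-! ### Straightening along the flow on `z = 0` -/

/-- Flowing back for the time `E` along `u' = k(u, 0, ε)` turns the first equation into
`y' = zE g(y, z, E)`. -/
theorem exists_straightening {k : ℝ × ℝ × ℝ → ℝ} (hk : ContDiff ℝ ∞ k)
    (hs : HasCompactSupport k) :
    ∃ ψ g : ℝ × ℝ × ℝ → ℝ, ContDiff ℝ ∞ ψ ∧ ContDiff ℝ ∞ g ∧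
      (∀ p, 0 < fderiv ℝ ψ p (1, 0, 0)) ∧
      (∀ x z w, fderiv ℝ ψ (x, z, w) (k (x, z, z * w) * w, -z, w) =
        z * w * g (ψ (x, z, w), z, w)) ∧
      (PropertyF k univ → InfDivisible g) := by
  have hf : ContDiff ℝ ∞ fun v : ℝ × ℝ => k (v.1, 0, v.2) := hk.comp (by fun_prop)
  have hfs : HasCompactSupport fun v : ℝ × ℝ => k (v.1, 0, v.2) :=
    hs.comp_isClosedEmbedding (g := fun v : ℝ × ℝ => (v.1, (0 : ℝ), v.2))
      (Function.LeftInverse.isClosedEmbedding (f := fun p : ℝ × ℝ × ℝ => (p.1, p.2.2))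
        (fun _ => rfl) (by fun_prop) (by fun_prop))
  obtain ⟨φ, hφ, h0, hd, hpos, hgrp⟩ := exists_smooth_flow hf hfs
  obtain ⟨k₁, hk₁, hke⟩ := exists_hadamard_z hk
  have hφd (q) : HasFDerivAt φ (fderiv ℝ φ q) q :=
    ((hφ.differentiable (by simp)).differentiableAt (x := q)).hasFDerivAt
  have hφx : ContDiff ℝ ∞ fun q => fderiv ℝ φ q ((1, 0), 0) :=
    (hφ.fderiv_right (m := ∞) (by simp)).clm_apply contDiff_const
  -- the time derivative, from the group property
  have htime (x ε t : ℝ) : fderiv ℝ φ ((x, ε), t) (0, 1) =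
      k (x, 0, ε) * fderiv ℝ φ ((x, ε), t) ((1, 0), 0) := by
    have h1 : HasDerivAt (fun s => φ ((φ ((x, ε), s), ε), t))
        (fderiv ℝ φ ((x, ε), t) ((k (x, 0, ε), 0), 0)) 0 := by
      have hin := hd (x, ε) 0
      simp only [h0] at hin
      refine HasFDerivAt.comp_hasDerivAt (l := φ) (f := fun s => ((φ ((x, ε), s), ε), t)) (0 : ℝ)
        ?_ ((hin.prodMk (hasDerivAt_const _ ε)).prodMk (hasDerivAt_const _ t))
      simpa [h0] using hφd ((x, ε), t)
    have h2 : HasDerivAt (fun s => φ ((φ ((x, ε), s), ε), t))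
        (fderiv ℝ φ ((x, ε), t) (0, 1)) 0 := by
      simp only [hgrp]
      refine HasFDerivAt.comp_hasDerivAt (l := φ) (f := fun s => ((x, ε), s + t)) (0 : ℝ)
        ?_ ((hasDerivAt_const _ (x, ε)).prodMk ((hasDerivAt_id (0 : ℝ)).add_const t))
      simpa using hφd ((x, ε), t)
    rw [h2.unique h1, ← smul_eq_mul, ← map_smul]
    simp
  have hιd (x z w c d e : ℝ) : fderiv ℝ (fun p : ℝ × ℝ × ℝ => φ ((p.1, p.2.1 * p.2.2), -p.2.2))
      (x, z, w) (c, d, e) = fderiv ℝ φ ((x, z * w), -w) ((c, d * w + z * e), -e) := by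
    have hι := ((hasFDerivAt_fst (𝕜 := ℝ) (p := (x, z, w))).prodMk
      ((hasFDerivAt_snd_fst (x, z, w)).mul (hasFDerivAt_snd_snd (x, z, w)))).prodMk
      (hasFDerivAt_snd_snd (x, z, w)).neg
    have h := HasFDerivAt.comp (x, z, w) (hφd ((x, z * w), -w)) hι
    refine (congrArg (fun l => l (c, d, e)) h.fderiv).trans ?_
    simp
    congr 3
    ring
  refine ⟨fun p => φ ((p.1, p.2.1 * p.2.2), -p.2.2),
    fun p => k₁ (φ ((p.1, p.2.1 * p.2.2), p.2.2), p.2.1, p.2.1 * p.2.2) *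
      fderiv ℝ φ ((φ ((p.1, p.2.1 * p.2.2), p.2.2), p.2.1 * p.2.2), -p.2.2) ((1, 0), 0),
    hφ.comp (by fun_prop), ?_, ?_, fun x z w => ?_, fun hF => ?_⟩
  · exact (hk₁.comp (by fun_prop)).mul (hφx.comp (g := fun q => fderiv ℝ φ q ((1, 0), 0))
      (f := fun p : ℝ × ℝ × ℝ => ((φ ((p.1, p.2.1 * p.2.2), p.2.2), p.2.1 * p.2.2), -p.2.2))
      (by fun_prop))
  · rintro ⟨x, z, w⟩
    rw [hιd]
    simpa using hpos ((x, z * w), -w)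
  · have hv : (((k (x, z, z * w) * w, -z * w + z * w), -w) : (ℝ × ℝ) × ℝ) =
        (k (x, z, z * w) * w) • ((1, 0), 0) + (-w) • (0, 1) := by simp
    simp only
    rw [hιd, hv, map_add, map_smul, map_smul, htime, hgrp, neg_add_cancel, h0, hke x z]
    simp only [smul_eq_mul]
    ring
  · have hdiv : InfDivisible fun p => k p - k (p.1, 0, p.2.2) :=
      FlatInZ.infDivisible hF (hk.sub (hk.comp (by fun_prop)))
    have hk₁f : InfDivisible k₁ := hdiv.div_z hk₁ fun x z w => by
      simp only
      rw [hke x z w]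
      ring
    intro M
    obtain ⟨u, hu, hue⟩ := hk₁f M
    refine ⟨fun p => u (φ ((p.1, p.2.1 * p.2.2), p.2.2), p.2.1, p.2.1 * p.2.2) *
      fderiv ℝ φ ((φ ((p.1, p.2.1 * p.2.2), p.2.2), p.2.1 * p.2.2), -p.2.2) ((1, 0), 0), ?_,
      fun x z w => by simp only [hue]; ring⟩
    exact (hu.comp (by fun_prop)).mul (hφx.comp (g := fun q => fderiv ℝ φ q ((1, 0), 0))
      (f := fun p : ℝ × ℝ × ℝ => ((φ ((p.1, p.2.1 * p.2.2), p.2.2), p.2.1 * p.2.2), -p.2.2))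
      (by fun_prop))

/-- The new coordinate `η` as a function on the whole space. It is increasing in `x` wherever
`1 + zE κ` is positive, in particular for `zE` small on a compact set. The remainder `b` is
expressed in the original coordinates. -/
theorem exists_global_normal_form {k : ℝ × ℝ × ℝ → ℝ} (hk : ContDiff ℝ ∞ k)
    (hs : HasCompactSupport k) {N : ℕ} (hN : 1 ≤ N) :
    ∃ (η κ : ℝ × ℝ × ℝ → ℝ) (a : ℝ × ℝ → ℝ) (b : ℝ × ℝ × ℝ → ℝ),
      ContDiff ℝ ∞ η ∧ Continuous κ ∧ ContDiff ℝ ∞ a ∧ ContDiff ℝ ∞ b ∧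
      (∀ p, 0 < 1 + p.2.1 * p.2.2 * κ p → 0 < fderiv ℝ η p (1, 0, 0)) ∧
      (∀ p, fderiv ℝ η p (saddleField k p) =
        p.2.1 * p.2.2 * a (η p, p.2.1 * p.2.2) + (p.2.1 * p.2.2) ^ N * b p) ∧
      (PropertyF k univ → a = 0 ∧ InfDivisible b) := by
  obtain ⟨ψ, g, hψ, hg, hψpos, hψX, hgF⟩ := exists_straightening hk hs
  obtain ⟨n, rfl⟩ := Nat.exists_eq_add_of_le' hN
  obtain ⟨R, a, b, hR, ha, hb, he, hflat⟩ := exists_normal_form hg n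
  let Θ : ℝ × ℝ × ℝ → ℝ × ℝ × ℝ := fun p => (ψ p, p.2)
  have hΘ : ContDiff ℝ ∞ Θ := hψ.prodMk contDiff_snd
  have hRx : ContDiff ℝ ∞ fun p => fderiv ℝ R p (1, 0, 0) :=
    (hR.fderiv_right (m := ∞) (by simp)).clm_apply contDiff_const
  have hηd (x z w c d e : ℝ) (hde : d * w + z * e = 0) :
      fderiv ℝ (fun p => ψ p + p.2.1 * p.2.2 * R (Θ p)) (x, z, w) (c, d, e) =
        fderiv ℝ ψ (x, z, w) (c, d, e) +
          z * w * fderiv ℝ R (ψ (x, z, w), z, w) (fderiv ℝ ψ (x, z, w) (c, d, e), d, e) := by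
    have hψ' := ((hψ.differentiable (by simp)).differentiableAt (x := (x, z, w))).hasFDerivAt
    have hR' := HasFDerivAt.comp (x, z, w)
      ((hR.differentiable (by simp)).differentiableAt (x := Θ (x, z, w))).hasFDerivAt
      (hψ'.prodMk (hasFDerivAt_snd (𝕜 := ℝ) (p := (x, z, w))))
    have hη' := hψ'.add
      (((hasFDerivAt_snd_fst (x, z, w)).mul (hasFDerivAt_snd_snd (x, z, w))).mul hR')
    refine (congrArg (fun l => l (c, d, e)) hη'.fderiv).trans ?_
    simp [Θ]
    linear_combination R (ψ (x, z, w), z, w) * hde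
  refine ⟨fun p => ψ p + p.2.1 * p.2.2 * R (Θ p), fun p => fderiv ℝ R (Θ p) (1, 0, 0), a,
    fun p => b (Θ p), ?_, (hRx.comp hΘ).continuous, ha, hb.comp hΘ, ?_, ?_, fun hF => ?_⟩
  · exact hψ.add ((by fun_prop : ContDiff ℝ ∞ fun p : ℝ × ℝ × ℝ => p.2.1 * p.2.2).mul
      (hR.comp hΘ))
  · rintro ⟨x, z, w⟩ hp
    rw [hηd _ _ _ _ _ _ (by ring)]
    have hv : ((fderiv ℝ ψ (x, z, w) (1, 0, 0), 0, 0) : ℝ × ℝ × ℝ) =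
        fderiv ℝ ψ (x, z, w) (1, 0, 0) • (1, 0, 0) := by simp
    rw [hv, map_smul, smul_eq_mul]
    have := mul_pos (hψpos (x, z, w)) hp
    simp only [Θ] at this
    linarith
  · rintro ⟨x, z, w⟩
    simp only [saddleField, Θ]
    rw [hηd _ _ _ _ _ _ (by ring), hψX]
    linear_combination z * w * he (ψ (x, z, w)) z w
  · obtain ⟨ha0, hbf⟩ := hflat (hgF hF)
    refine ⟨ha0, fun M => ?_⟩
    obtain ⟨u, hu, hue⟩ := hbf M
    exact ⟨fun p => u (Θ p), hu.comp hΘ, fun x z w => hue _ _ _⟩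

/-! ### Coordinate changes that only alter `x` -/

theorem injOn_of_fderiv_pos {η : ℝ × ℝ × ℝ → ℝ} (hη : ContDiff ℝ ∞ η) {W : Set (ℝ × ℝ × ℝ)}
    (hconv : ∀ v : ℝ × ℝ, Convex ℝ {x : ℝ | (x, v) ∈ W})
    (hpos : ∀ p ∈ W, 0 < fderiv ℝ η p (1, 0, 0)) : InjOn (fun p => (η p, p.2)) W := by
  rintro ⟨x, v⟩ hx ⟨y, v'⟩ hy hxy
  obtain ⟨h1, rfl⟩ : η (x, v) = η (y, v') ∧ v = v' := by simpa using hxy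
  have hd (x : ℝ) : HasDerivAt (fun x => η (x, v)) (fderiv ℝ η (x, v) (1, 0, 0)) x :=
    ((hη.differentiable (by simp)).differentiableAt (x := (x, v))).hasFDerivAt.comp_hasDerivAt x
      ((hasDerivAt_id x).prodMk (hasDerivAt_const x v))
  have hmono : StrictMonoOn (fun x => η (x, v)) {x : ℝ | (x, v) ∈ W} :=
    strictMonoOn_of_deriv_pos (hconv v) (fun x _ => (hd x).continuousAt.continuousWithinAt)
      fun x hx => by
        rw [(hd x).deriv]
        exact hpos (x, v) (interior_subset (s := {x : ℝ | (x, v) ∈ W}) hx)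
  rw [hmono.injOn hx hy h1]

/-- A smooth function that is increasing in `x` on an open set with convex `x`-slices defines a
smooth coordinate change there. -/
theorem exists_coordinateChange {η : ℝ × ℝ × ℝ → ℝ} (hη : ContDiff ℝ ∞ η)
    {W : Set (ℝ × ℝ × ℝ)} (hW : IsOpen W)
    (hconv : ∀ v : ℝ × ℝ, Convex ℝ {x : ℝ | (x, v) ∈ W})
    (hpos : ∀ p ∈ W, 0 < fderiv ℝ η p (1, 0, 0)) :
    ∃ Φ : OpenPartialHomeomorph (ℝ × ℝ × ℝ) (ℝ × ℝ × ℝ), Φ.source = W ∧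
      (∀ p, Φ p = (η p, p.2)) ∧ IsSmoothCoordinateChange Φ := by
  let F : ℝ × ℝ × ℝ → ℝ × ℝ × ℝ := fun p => (η p, p.2)
  have hF : ContDiff ℝ ∞ F := hη.prodMk contDiff_snd
  have hFd (p : ℝ × ℝ × ℝ) : HasFDerivAt F
      ((fderiv ℝ η p).prod (ContinuousLinearMap.snd ℝ ℝ (ℝ × ℝ))) p :=
    ((hη.differentiable (by simp)).differentiableAt (x := p)).hasFDerivAt.prodMk hasFDerivAt_snd
  have hequiv (p) (hp : p ∈ W) : ∃ e : (ℝ × ℝ × ℝ) ≃L[ℝ] (ℝ × ℝ × ℝ),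
      HasFDerivAt F (e : (ℝ × ℝ × ℝ) →L[ℝ] (ℝ × ℝ × ℝ)) p := by
    have hinj : Function.Injective
        ((fderiv ℝ η p).prod (ContinuousLinearMap.snd ℝ ℝ (ℝ × ℝ))).toLinearMap := by
      refine (injective_iff_map_eq_zero _).2 ?_
      rintro ⟨u, v⟩ huv
      obtain ⟨h1, h2⟩ : fderiv ℝ η p (u, v) = 0 ∧ v = 0 := Prod.ext_iff.1 huv
      subst h2
      have hu : ((u, 0) : ℝ × ℝ × ℝ) = u • (1, 0, 0) := by
        ext <;> simp
      rw [hu, map_smul, smul_eq_mul, mul_eq_zero] at h1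
      rw [h1.resolve_right (hpos p hp).ne', Prod.mk_zero_zero]
    refine ⟨(LinearEquiv.ofInjectiveEndo _ hinj).toContinuousLinearEquiv, ?_⟩
    have he : ((LinearEquiv.ofInjectiveEndo _ hinj).toContinuousLinearEquiv :
        (ℝ × ℝ × ℝ) →L[ℝ] (ℝ × ℝ × ℝ)) =
        (fderiv ℝ η p).prod (ContinuousLinearMap.snd ℝ ℝ (ℝ × ℝ)) :=
      ContinuousLinearMap.ext fun _ => rfl
    rw [he]
    exact hFd p
  have hopen : IsOpenMap (W.domRestrict F) := by
    refine isOpenMap_iff_nhds_le.2 fun p => ?_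
    obtain ⟨e, he⟩ := hequiv p p.2
    have h1 := (hF.contDiffAt.hasStrictFDerivAt' he (by simp)).map_nhds_eq_of_equiv
    have h2 : map (W.domRestrict F) (𝓝 p) = map F (𝓝 (p : ℝ × ℝ × ℝ)) := by
      rw [← map_nhds_subtype_coe_eq_nhds p.2 (hW.mem_nhds p.2), Filter.map_map]
      rfl
    rw [h2, h1]
    rfl
  let Φ := OpenPartialHomeomorph.ofContinuousOpenRestrict
    ((injOn_of_fderiv_pos hη hconv hpos).toPartialEquiv F W) hF.continuous.continuousOn hopen hW
  refine ⟨Φ, rfl, fun _ => rfl, hF.contDiffOn, fun q hq => ?_, fun _ _ => rfl⟩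
  obtain ⟨e, he⟩ := hequiv (Φ.symm q) (Φ.map_target hq)
  exact (Φ.contDiffAt_symm hq he hF.contDiffAt).contDiffWithinAt

theorem InfDivisible.flatInZ_comp {b : ℝ × ℝ × ℝ → ℝ} (hb : InfDivisible b)
    {V : Set (ℝ × ℝ × ℝ)} (hV : IsOpen V) {G : ℝ × ℝ × ℝ → ℝ × ℝ × ℝ} (hG : ContinuousOn G V)
    (hsnd : ∀ q ∈ V, (G q).2 = q.2) : FlatInZ (fun q => b (G q)) V := by
  intro u w hu M
  obtain ⟨h, hh, he⟩ := hb M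
  have hι : ContinuousAt (fun z : ℝ => (u, z, w)) 0 := by fun_prop
  have hc : ContinuousAt (fun z : ℝ => h (G (u, z, w))) 0 :=
    hh.continuous.continuousAt.comp
      (ContinuousAt.comp (f := fun z : ℝ => (u, z, w)) (hG.continuousAt (hV.mem_nhds hu)) hι)
  have h1 := (Asymptotics.isBigO_refl (fun z : ℝ => z ^ M) (𝓝 0)).mul (hc.isBigO_one ℝ)
  simp only [mul_one] at h1
  refine h1.congr' ?_ .rfl
  filter_upwards [hι.preimage_mem_nhds (hV.mem_nhds hu)] with z hz
  have h2 : (G (u, z, w)).2.1 = z := by rw [hsnd _ hz]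
  exact (congrArg (fun t => t ^ M * h (G (u, z, w))) h2.symm).trans (he _ _ _).symm

/-! ### Cutting off -/

theorem exists_compact_box_subset {Ω : Set (ℝ × ℝ × ℝ)} (hΩ : IsOpen Ω) {x₁ x₂ : ℝ}
    (hx : x₁ ≤ x₂) (hseg : ∀ x ∈ Icc x₁ x₂, (x, (0 : ℝ), (0 : ℝ)) ∈ Ω) :
    ∃ ρ : ℝ, 0 < ρ ∧
      Icc (x₁ - 2 * ρ) (x₂ + 2 * ρ) ×ˢ Icc (-(2 * ρ)) (2 * ρ) ×ˢ Icc (-(2 * ρ)) (2 * ρ) ⊆ Ω := by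
  have hK : IsCompact (Icc x₁ x₂ ×ˢ ({0} : Set ℝ) ×ˢ ({0} : Set ℝ)) :=
    isCompact_Icc.prod (isCompact_singleton.prod isCompact_singleton)
  obtain ⟨d, hd, hsub⟩ := hK.exists_cthickening_subset_open hΩ (by
    rintro ⟨x, z, w⟩ ⟨hx, hz, hw⟩
    obtain rfl : z = 0 := hz
    obtain rfl : w = 0 := hw
    exact hseg x hx)
  refine ⟨d / 2, by positivity, ?_⟩
  rintro ⟨x, z, w⟩ ⟨hx', hz, hw⟩
  simp only [mem_Icc] at hx' hz hw
  refine hsub (Metric.mem_cthickening_of_dist_le (x, z, w) (max x₁ (min x x₂), 0, 0) d _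
    ⟨⟨le_max_left _ _, max_le hx (min_le_right _ _)⟩, rfl, rfl⟩ ?_)
  simp only [Prod.dist_eq, Real.dist_eq, sub_zero]
  refine max_le ?_ (max_le (abs_le.2 ⟨by linarith, by linarith⟩)
    (abs_le.2 ⟨by linarith, by linarith⟩))
  rcases le_total x x₂ with h | h
  · rw [min_eq_left h]
    rcases le_total x₁ x with h' | h'
    · rw [max_eq_right h', sub_self, abs_zero]
      exact hd.le
    · rw [max_eq_left h']
      exact abs_le.2 ⟨by linarith, by linarith⟩
  · rw [min_eq_right h, max_eq_right hx]
    exact abs_le.2 ⟨by linarith, by linarith⟩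

/-- The function `k` agrees near the segment with a compactly supported smooth function on the
whole space. The cutoff is a product of functions of one variable, constant for small `z`, so that
property `F` survives. -/
theorem exists_cutoff {k : ℝ × ℝ × ℝ → ℝ} {Ω : Set (ℝ × ℝ × ℝ)} (hΩ : IsOpen Ω)
    (hk : ContDiffOn ℝ ∞ k Ω) {x₁ x₂ : ℝ} (hx : x₁ ≤ x₂)
    (hseg : ∀ x ∈ Icc x₁ x₂, (x, (0 : ℝ), (0 : ℝ)) ∈ Ω) :
    ∃ (ρ : ℝ) (K : ℝ × ℝ × ℝ → ℝ), 0 < ρ ∧ ContDiff ℝ ∞ K ∧ HasCompactSupport K ∧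
      (∀ x z w, x ∈ Icc (x₁ - ρ) (x₂ + ρ) → |z| ≤ ρ → |w| ≤ ρ →
        (x, z, w) ∈ Ω ∧ K (x, z, w) = k (x, z, w)) ∧
      (PropertyF k Ω → PropertyF K univ) := by
  obtain ⟨ρ, hρ, hsub⟩ := exists_compact_box_subset hΩ hx hseg
  set C := Icc (x₁ - 2 * ρ) (x₂ + 2 * ρ) ×ˢ Icc (-(2 * ρ)) (2 * ρ) ×ˢ Icc (-(2 * ρ)) (2 * ρ)
    with hC
  have hCc : IsCompact C := isCompact_Icc.prod (isCompact_Icc.prod isCompact_Icc)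
  let c₁ : ContDiffBump ((x₁ + x₂) / 2) :=
    ⟨(x₂ - x₁) / 2 + ρ, (x₂ - x₁) / 2 + 2 * ρ, by linarith, by linarith⟩
  let c₀ : ContDiffBump (0 : ℝ) := ⟨ρ, 2 * ρ, hρ, by linarith⟩
  have hc₁ (x : ℝ) (h : x ∈ Icc (x₁ - ρ) (x₂ + ρ)) : c₁ x = 1 :=
    c₁.one_of_mem_closedBall (by
      rw [Metric.mem_closedBall, Real.dist_eq]
      exact abs_le.2 ⟨by change -((x₂ - x₁) / 2 + ρ) ≤ _; linarith [h.1],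
        by change _ ≤ (x₂ - x₁) / 2 + ρ; linarith [h.2]⟩)
  have hc₀ (x : ℝ) (h : |x| ≤ ρ) : c₀ x = 1 :=
    c₀.one_of_mem_closedBall (by simpa [Real.dist_eq] using h)
  have hc₁z (x : ℝ) (h : x ∉ Icc (x₁ - 2 * ρ) (x₂ + 2 * ρ)) : c₁ x = 0 :=
    c₁.zero_of_le_dist (by
      by_contra! h'
      rw [Real.dist_eq] at h'
      have h' : |x - (x₁ + x₂) / 2| < (x₂ - x₁) / 2 + 2 * ρ := h'
      rw [abs_lt] at h'
      exact h ⟨by linarith [h'.1], by linarith [h'.2]⟩)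
  have hc₀z (x : ℝ) (h : x ∉ Icc (-(2 * ρ)) (2 * ρ)) : c₀ x = 0 :=
    c₀.zero_of_le_dist (by
      by_contra! h'
      rw [Real.dist_eq, sub_zero] at h'
      exact h (abs_le.1 (le_of_lt h')))
  let K : ℝ × ℝ × ℝ → ℝ := fun p => c₁ p.1 * c₀ p.2.1 * c₀ p.2.2 * k p
  have hK0 (p) (hp : p ∉ C) : K p = 0 := by
    obtain ⟨x, z, w⟩ := p
    by_cases h1 : x ∈ Icc (x₁ - 2 * ρ) (x₂ + 2 * ρ)
    · by_cases h2 : z ∈ Icc (-(2 * ρ)) (2 * ρ)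
      · by_cases h3 : w ∈ Icc (-(2 * ρ)) (2 * ρ)
        · exact absurd ⟨h1, h2, h3⟩ hp
        · simp [K, hc₀z w h3]
      · simp [K, hc₀z z h2]
    · simp [K, hc₁z x h1]
  refine ⟨ρ, K, hρ, ?_, HasCompactSupport.intro hCc fun p hp => hK0 p hp, ?_, fun hF => ?_⟩
  · refine contDiff_iff_contDiffAt.2 fun p => ?_
    by_cases hp : p ∈ Ω
    · have h1 : ContDiffAt ℝ ∞ k p := hk.contDiffAt (hΩ.mem_nhds hp)
      have h2 : ContDiff ℝ ∞ fun p : ℝ × ℝ × ℝ => c₁ p.1 * c₀ p.2.1 * c₀ p.2.2 :=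
        ((c₁.contDiff.comp contDiff_fst).mul
          (c₀.contDiff.comp (by fun_prop : ContDiff ℝ ∞ fun p : ℝ × ℝ × ℝ => p.2.1))).mul
          (c₀.contDiff.comp (by fun_prop : ContDiff ℝ ∞ fun p : ℝ × ℝ × ℝ => p.2.2))
      exact h2.contDiffAt.mul h1
    · refine (contDiffAt_const (c := (0 : ℝ))).congr_of_eventuallyEq ?_
      filter_upwards [hCc.isClosed.isOpen_compl.mem_nhds fun h => hp (hsub h)] with q hq
      exact hK0 q hq
  · intro x z w hx' hz hw
    refine ⟨hsub ⟨⟨by linarith [hx'.1], by linarith [hx'.2]⟩, ?_, ?_⟩, ?_⟩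
    · rw [abs_le] at hz
      exact ⟨by linarith [hz.1], by linarith [hz.2]⟩
    · rw [abs_le] at hw
      exact ⟨by linarith [hw.1], by linarith [hw.2]⟩
    · simp [K, hc₁ x hx', hc₀ z hz, hc₀ w hw]
  · intro u w _ M
    by_cases hu : (u, (0 : ℝ), w) ∈ Ω
    · refine ((hF u w hu M).const_mul_left (c₁ u * c₀ w)).congr' ?_ .rfl
      filter_upwards [Metric.closedBall_mem_nhds (0 : ℝ) hρ] with z hz
      simp only [K, hc₀ z (by simpa using hz), hc₀ 0 (by simpa using hρ.le)]
      ring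
    · have h0 : c₁ u * c₀ w = 0 := by
        by_contra hne
        refine hu (hsub ⟨?_, ⟨by linarith, by linarith⟩, ?_⟩)
        · by_contra h
          exact hne (by rw [hc₁z u h, zero_mul])
        · by_contra h
          exact hne (by rw [hc₀z w h, mul_zero])
      refine (Asymptotics.isBigO_zero (fun z : ℝ => z ^ M) (𝓝 0)).congr_left fun z => ?_
      simp only [K]
      linear_combination -(c₀ z * k (u, z, w) - c₀ 0 * k (u, 0, w)) * h0

theorem isOpen_box (x₁ x₂ r : ℝ) : IsOpen (box x₁ x₂ r) := by
  unfold box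
  simp only [ofPred_and]
  refine .inter (isOpen_lt ?_ ?_) (.inter (isOpen_lt ?_ ?_)
    (.inter (isOpen_lt ?_ ?_) (isOpen_lt ?_ ?_))) <;> fun_prop

end EntryExit

/-! ### The normal form -/

theorem mainTheorem5
    (k : ℝ × ℝ × ℝ → ℝ) (Ω : Set (ℝ × ℝ × ℝ)) (hΩ : IsOpen Ω)
    (hk : ContDiffOn ℝ ∞ k Ω)
    (x₁ x₂ : ℝ) (hx : x₁ ≤ x₂) (hseg : ∀ x ∈ Icc x₁ x₂, (x, (0 : ℝ), (0 : ℝ)) ∈ Ω) :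
    ∃ r : ℝ, 0 < r ∧
      (∀ p ∈ EntryExit.box x₁ x₂ r, (p.1, p.2.1, p.2.1 * p.2.2) ∈ Ω) ∧
      ∀ N : ℕ, 1 ≤ N →
        ∃ δ : ℝ, 0 < δ ∧
          ∃ (Φ : OpenPartialHomeomorph (ℝ × ℝ × ℝ) (ℝ × ℝ × ℝ))
            (a : ℝ × ℝ → ℝ) (b : ℝ × ℝ × ℝ → ℝ),
            Φ.source = {p ∈ EntryExit.box x₁ x₂ r | |p.2.1 * p.2.2| < δ} ∧
            EntryExit.IsSmoothCoordinateChange Φ ∧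
            ContDiffOn ℝ ∞ a ((fun p : ℝ × ℝ × ℝ => (p.1, p.2.1 * p.2.2)) '' Φ.target) ∧
            ContDiffOn ℝ ∞ b Φ.target ∧
            EntryExit.Transforms Φ (EntryExit.saddleField k)
              (EntryExit.normalFormField N a b) ∧
            (EntryExit.PropertyF k Ω → a = 0 ∧ EntryExit.FlatInZ b Φ.target) := by
  obtain ⟨ρ, K, hρ, hK, hKs, hKk, hKF⟩ := EntryExit.exists_cutoff hΩ hk hx hseg
  have hr : 0 < min ρ 1 := lt_min hρ one_pos
  -- `r ≤ 1` keeps `|zE| ≤ r` on the box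
  have hbox : ∀ p ∈ EntryExit.box x₁ x₂ (min ρ 1), (p.1, p.2.1, p.2.1 * p.2.2) ∈ Ω ∧
      K (p.1, p.2.1, p.2.1 * p.2.2) = k (p.1, p.2.1, p.2.1 * p.2.2) := by
    rintro ⟨x, z, w⟩ ⟨h1, h2, h3, h4⟩
    simp only at h1 h2 h3 h4
    have hrρ : min ρ 1 ≤ ρ := min_le_left _ _
    refine hKk _ _ _ ⟨by linarith, by linarith⟩ (h3.le.trans hrρ) ?_
    rw [abs_mul]
    calc |z| * |w| ≤ ρ * 1 := mul_le_mul (h3.le.trans hrρ) (h4.le.trans (min_le_right _ _))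
          (abs_nonneg w) hρ.le
      _ = ρ := mul_one ρ
  refine ⟨min ρ 1, hr, fun p hp => (hbox p hp).1, fun N hN => ?_⟩
  generalize min ρ 1 = r at hr hbox
  obtain ⟨η, κ, a, b, hη, hκ, ha, hb, hpos, hX, hflat⟩ :=
    EntryExit.exists_global_normal_form hK hKs hN
  have hcomp : IsCompact (Icc (x₁ - r) (x₂ + r) ×ˢ Icc (-r) r ×ˢ Icc (-r) r) :=
    isCompact_Icc.prod (isCompact_Icc.prod isCompact_Icc)
  obtain ⟨M, hM⟩ := hcomp.exists_bound_of_continuousOn hκ.continuousOn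
  have hδ : 0 < 1 / (|M| + 1) := by positivity
  have hWopen : IsOpen {p ∈ EntryExit.box x₁ x₂ r | |p.2.1 * p.2.2| < 1 / (|M| + 1)} :=
    (EntryExit.isOpen_box x₁ x₂ r).inter
      (isOpen_lt (f := fun p : ℝ × ℝ × ℝ => |p.2.1 * p.2.2|) (by fun_prop) continuous_const)
  have hWpos : ∀ p ∈ {p ∈ EntryExit.box x₁ x₂ r | |p.2.1 * p.2.2| < 1 / (|M| + 1)},
      0 < fderiv ℝ η p (1, 0, 0) := by
    rintro p ⟨⟨h1, h2, h3, h4⟩, h5⟩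
    refine hpos p ?_
    have hp := hM p ⟨⟨h1.le, h2.le⟩, abs_le.1 h3.le, abs_le.1 h4.le⟩
    rw [Real.norm_eq_abs] at hp
    have h6 : |p.2.1 * p.2.2 * κ p| < 1 := by
      rw [abs_mul]
      calc |p.2.1 * p.2.2| * |κ p| ≤ |p.2.1 * p.2.2| * (|M| + 1) := by
            gcongr
            linarith [le_abs_self M]
        _ < 1 / (|M| + 1) * (|M| + 1) := by gcongr
        _ = 1 := by field_simp
    linarith [(abs_lt.1 h6).1]
  have hWconv (v : ℝ × ℝ) : Convex ℝ
      {x : ℝ | (x, v) ∈ {p ∈ EntryExit.box x₁ x₂ r | |p.2.1 * p.2.2| < 1 / (|M| + 1)}} := by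
    refine Set.OrdConnected.convex ⟨?_⟩
    rintro x ⟨⟨h1, -, h3⟩, h4⟩ y ⟨⟨-, h2, -⟩, -⟩ s ⟨hs1, hs2⟩
    exact ⟨⟨lt_of_lt_of_le h1 hs1, lt_of_le_of_lt hs2 h2, h3⟩, h4⟩
  obtain ⟨Φ, hΦs, hΦ, hΦc⟩ := EntryExit.exists_coordinateChange hη hWopen hWconv hWpos
  have hsymm : ∀ q ∈ Φ.target, (Φ.symm q).2 = q.2 := fun q hq => by
    rw [← hΦc.snd_eq _ (Φ.map_target hq), Φ.right_inv hq]
  refine ⟨1 / (|M| + 1), hδ, Φ, a, fun q => b (Φ.symm q), hΦs, hΦc, ha.contDiffOn,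
    hb.comp_contDiffOn hΦc.contDiffOn_symm, fun p hp => ?_, fun hF => ?_⟩
  · have hpW := hp
    rw [hΦs] at hpW
    have hsf : EntryExit.saddleField k p = EntryExit.saddleField K p := by
      simp only [EntryExit.saddleField, (hbox p hpW.1).2]
    have hd : HasFDerivAt Φ ((fderiv ℝ η p).prod (ContinuousLinearMap.snd ℝ ℝ (ℝ × ℝ))) p :=
      (((hη.differentiable (by simp)).differentiableAt (x := p)).hasFDerivAt.prodMk
        hasFDerivAt_snd).congr_of_eventuallyEq (.of_forall hΦ)
    rw [hsf, hd.fderiv]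
    simp only [EntryExit.normalFormField, Φ.left_inv hp]
    rw [hΦ, ContinuousLinearMap.prod_apply, hX]
    rfl
  · obtain ⟨ha0, hbf⟩ := hflat (hKF hF)
    exact ⟨ha0, hbf.flatInZ_comp Φ.open_target hΦc.contDiffOn_symm.continuousOn hsymm⟩
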